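/- Let $\mathbb{D}=\{z\in\mathbb{C}:|z|<1\}$, let $\mu,\nu\in\mathbb{R}$, let $A,B\ge 0$ with $A+B>0$, and put $\psi_{\mu,\nu}(z)=(1-2ze^{i\mu}\cos\nu+z^2e^{2i\mu})^{-1}$. For $k=1,2$ let $h_k,g_k$ be analytic on $\mathbb{D}$ such that the harmonic mapping $f_k=h_k+\overline{g_k}$ is locally univalent and sense-preserving on $\mathbb{D}$ (sense-preserving: its Jacobian $|h_k'|^2-|g_k'|^2$ is positive), and suppose that $$h_k(z)-e^{-2i\mu}g_k(z)=A\cdot\frac{1}{2e^{i\mu}}\log\left(\frac{1+ze^{i\mu}}{1-ze^{i\mu}}\right)+B\cdot z\psi_{\mu,\nu}(z),\qquad z\in\mathbb{D},$$ with the principal branch of the logarithm. For $\eta\in\mathbb{C}$ let $f=\eta h_1+(1-\eta)h_2+\overline{\eta g_1+(1-\eta)g_2}$, and let $\omega_k=g_k'/h_k'$ be the dilatation of $f_k$. Then: 1. For every real $\eta$ with $0\le\eta\le1$, $f$ is univalent on $\mathbb{D}$ and convex in the direction $-\mu$. 2. If $\alpha_1,\alpha_2\le 1$ and $|\omega_k(z)|<\alpha_k$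 for all $z\in\mathbb{D}$ and $k=1,2$, then for every $\eta\in\mathbb{C}$ with $|\eta|\le\dfrac{(1-\alpha_1)(1-\alpha_2)}{2(\alpha_1+\alpha_2)}$, $f$ is univalent on $\mathbb{D}$ and convex in the direction $-\mu$. Here $f$ is convex in the direction $\gamma$ if $f(\mathbb{D})$ is a domain whose intersection with every line parallel to the line through $0$ and $e^{i\gamma}$ is connected (possibly empty). -/

import Mathlib

open Complex Topology

noncomputable section

/-- The open unit disk. -/
def unitDisk : Set ℂ := Metric.ball (0 : ℂ) 1

/-- The complex-valued function `h + conj g`, with analytic part `h` and co-analytic part `g`. -/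
def harmonicMap (h g : ℂ → ℂ) : ℂ → ℂ := fun z => h z + (starRingEnd ℂ) (g z)

/-- `f` is locally univalent on the unit disk: injective near every point. -/
def LocallyUnivalent (f : ℂ → ℂ) : Prop :=
  ∀ z ∈ unitDisk, ∃ U ∈ 𝓝 z, Set.InjOn f U

/-- `f` is sense-preserving on the unit disk: the Jacobian determinant of `f`, as a map of the
real plane, is positive at every point. -/
def SensePreserving (f : ℂ → ℂ) : Prop :=
  ∀ z ∈ unitDisk, 0 < (fderiv ℝ f z).det

/-- `h` and `g` are analytic on the unit disk, and `h + conj g` is a locally univalent and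
sense-preserving (harmonic) mapping there. -/
structure IsLocallyUnivalentSensePreserving (h g : ℂ → ℂ) : Prop where
  analytic_h : DifferentiableOn ℂ h unitDisk
  analytic_g : DifferentiableOn ℂ g unitDisk
  locallyUnivalent : LocallyUnivalent (harmonicMap h g)
  sensePreserving : SensePreserving (harmonicMap h g)

/-- The dilatation `g' / h'` of `h + conj g`. -/
def dilatation (h g : ℂ → ℂ) (z : ℂ) : ℂ := deriv g z / deriv h z

/-- `Ω` is a domain which is convex in the direction `γ`: its intersection with every line
parallel to the line through `0` and `exp (i γ)` is connected (possibly empty). -/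
def DomainConvexInDirection (Ω : Set ℂ) (γ : ℝ) : Prop :=
  IsOpen Ω ∧ IsConnected Ω ∧
    ∀ c : ℂ, IsPreconnected ({w : ℂ | ∃ t : ℝ, w = c + (t : ℂ) * exp ((γ : ℂ) * I)} ∩ Ω)

/-- `f` is univalent on the unit disk and maps it onto a domain convex in the direction `γ`. -/
def UnivalentConvexInDirection (f : ℂ → ℂ) (γ : ℝ) : Prop :=
  Set.InjOn f unitDisk ∧ DomainConvexInDirection (f '' unitDisk) γ

/-- `ψ_{μ,ν}(z) = (1 - 2 z exp(iμ) cos ν + z² exp(2iμ))⁻¹`. -/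
def psi (μ ν : ℝ) (z : ℂ) : ℂ :=
  (1 - 2 * z * exp ((μ : ℂ) * I) * (Real.cos ν : ℂ) + z ^ 2 * exp (2 * (μ : ℂ) * I))⁻¹

/-- `A · (2 exp(iμ))⁻¹ log ((1 + z exp(iμ)) / (1 - z exp(iμ))) + B · z ψ_{μ,ν}(z)`
(principal branch: the argument has positive real part on the unit disk). -/
def logPsiCombination (A B μ ν : ℝ) (z : ℂ) : ℂ :=
  (A : ℂ) * (1 / (2 * exp ((μ : ℂ) * I)) *
      log ((1 + z * exp ((μ : ℂ) * I)) / (1 - z * exp ((μ : ℂ) * I))))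
    + (B : ℂ) * (z * psi μ ν z)

/-- The combination `η h₁ + (1 - η) h₂ + conj (η g₁ + (1 - η) g₂)`. -/
def combination (η : ℂ) (h₁ g₁ h₂ g₂ : ℂ → ℂ) : ℂ → ℂ :=
  harmonicMap (fun z => η * h₁ z + (1 - η) * h₂ z) (fun z => η * g₁ z + (1 - η) * g₂ z)

end

/-! This is the shear principle of Clunie and Sheil-Small, proved directly on a strip. Write `e` for
`exp (μ * I)`. After multiplication by `e`, the map becomes `H + conj G`, and `H - G` is the shear
target in `e z`. Since `Im (H + conj G) = Im (H - G)`, horizontal sections of the image come from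
level sets of `Im (H - G)`.

The disk is parametrized by a vertical strip or half-plane on which `H - G` has derivative of
positive real part. Then `Im (H - G)` increases strictly up each vertical line, so a level set
meeting every vertical line is a continuous graph over `J`. On it `H + conj G` has constant
imaginary part and is locally injective, so its real part is injective. This gives univalence and
connected sections together (`shear_injOn_and_convex`).

In the Cayley variable `s = (1 + w) / (1 - w)`, the half-plane serves when `B = 0` or `cos ν = 1`;
`cos ν = -1` follows by symmetry, and the substitution `s = κ tan t` handles the rest. In each case
the derivative is a nonnegative combination of `z⁻¹` and `z` with `Re z > 0`.

It remains to see that the combination satisfies `|g'| < |h'|`. Both pairs share `h' - exp (-2iμ)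
g'`. For real weights the condition is then affine; for small complex `η` the triangle inequality
suffices. -/

/-! ### Local behaviour of `h + conj g` -/

/-- The real-linear map `v ↦ a v + conj (b v)`. -/
noncomputable def harmonicDerivative (a b : ℂ) : ℂ →L[ℝ] ℂ :=
  (ContinuousLinearMap.toSpanSingleton ℂ a).restrictScalars ℝ +
    (conjCLE : ℂ →L[ℝ] ℂ).comp ((ContinuousLinearMap.toSpanSingleton ℂ b).restrictScalars ℝ)

theorem harmonicDerivative_apply (a b v : ℂ) :
    harmonicDerivative a b v = v * a + (starRingEnd ℂ) (v * b) := by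
  simp [harmonicDerivative]

theorem det_harmonicDerivative (a b : ℂ) :
    (harmonicDerivative a b).det = ‖a‖ ^ 2 - ‖b‖ ^ 2 := by
  rw [ContinuousLinearMap.det, ← LinearMap.det_toMatrix Complex.basisOneI, Matrix.det_fin_two]
  simp only [LinearMap.toMatrix_apply, ContinuousLinearMap.coe_coe, harmonicDerivative_apply,
    ← Complex.normSq_eq_norm_sq, Complex.normSq_apply]
  simp
  ring

theorem hasStrictFDerivAt_harmonicMap {h g : ℂ → ℂ} {z a b : ℂ} (hh : HasStrictDerivAt h a z)
    (hg : HasStrictDerivAt g b z) :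
    HasStrictFDerivAt (harmonicMap h g) (harmonicDerivative a b) z := by
  have h1 := hh.hasStrictFDerivAt.restrictScalars ℝ
  have h2 := hg.hasStrictFDerivAt.restrictScalars ℝ
  exact h1.add ((conjCLE : ℂ →L[ℝ] ℂ).hasStrictFDerivAt.comp z h2)

/-- The invertible real-linear map `v ↦ a v + conj (b v)` for `‖b‖ < ‖a‖`. -/
theorem exists_equiv_harmonicDerivative {a b : ℂ} (hab : ‖b‖ < ‖a‖) :
    ∃ e : ℂ ≃L[ℝ] ℂ, (e : ℂ →L[ℝ] ℂ) = harmonicDerivative a b := by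
  have hinj : Function.Injective (harmonicDerivative a b : ℂ →ₗ[ℝ] ℂ) := by
    rw [injective_iff_map_eq_zero]
    intro v hv
    rw [ContinuousLinearMap.coe_coe, harmonicDerivative_apply] at hv
    have h1 := congrArg norm (eq_neg_of_add_eq_zero_left hv)
    rw [norm_neg, RCLike.norm_conj, norm_mul, norm_mul] at h1
    by_contra hne
    exact absurd (mul_left_cancel₀ (norm_ne_zero_iff.2 hne) h1) hab.ne'
  exact ⟨(LinearEquiv.ofInjectiveEndo _ hinj).toContinuousLinearEquiv, by ext; rfl⟩

theorem exists_injOn_harmonicMap {h g : ℂ → ℂ} {z a b : ℂ} (hh : HasStrictDerivAt h a z)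
    (hg : HasStrictDerivAt g b z) (hab : ‖b‖ < ‖a‖) :
    ∃ U ∈ 𝓝 z, Set.InjOn (harmonicMap h g) U := by
  obtain ⟨e, he⟩ := exists_equiv_harmonicDerivative hab
  have hf := hasStrictFDerivAt_harmonicMap hh hg
  rw [← he] at hf
  refine ⟨(hf.toOpenPartialHomeomorph _).source,
    (hf.toOpenPartialHomeomorph _).open_source.mem_nhds hf.mem_toOpenPartialHomeomorph_source, ?_⟩
  simpa using (hf.toOpenPartialHomeomorph _).injOn

theorem map_nhds_harmonicMap {h g : ℂ → ℂ} {z a b : ℂ} (hh : HasStrictDerivAt h a z)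
    (hg : HasStrictDerivAt g b z) (hab : ‖b‖ < ‖a‖) :
    Filter.map (harmonicMap h g) (𝓝 z) = 𝓝 (harmonicMap h g z) := by
  obtain ⟨e, he⟩ := exists_equiv_harmonicDerivative hab
  have hf := hasStrictFDerivAt_harmonicMap hh hg
  rw [← he] at hf
  exact hf.map_nhds_eq_of_equiv

/-! ### Local injectivity and level curves -/

theorem not_isLocalExtr_of_injOn {k : ℝ → ℝ} {x : ℝ} {W : Set ℝ} (hW : W ∈ 𝓝 x)
    (hc : ContinuousOn k W) (hi : Set.InjOn k W) : ¬ IsLocalExtr k x := by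
  intro hext
  obtain ⟨U, hU, hUk⟩ : ∃ U ∈ 𝓝 x, (∀ y ∈ U, k x ≤ k y) ∨ (∀ y ∈ U, k y ≤ k x) := by
    rcases hext with h | h
    exacts [⟨_, h, Or.inl fun y hy => hy⟩, ⟨_, h, Or.inr fun y hy => hy⟩]
  obtain ⟨ε, hε, hsub⟩ := Metric.nhds_basis_closedBall.mem_iff.1 (Filter.inter_mem hW hU)
  rw [Real.closedBall_eq_Icc] at hsub
  have hle : x - ε ≤ x + ε := by linarith
  have m1 : x - ε ∈ Set.Icc (x - ε) (x + ε) := ⟨le_rfl, hle⟩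
  have m2 : x ∈ Set.Icc (x - ε) (x + ε) := ⟨by linarith, by linarith⟩
  have m3 : x + ε ∈ Set.Icc (x - ε) (x + ε) := ⟨hle, le_rfl⟩
  have u1 := (hsub m1).2
  have u3 := (hsub m3).2
  have l1 : x - ε < x := by linarith
  have l3 : x < x + ε := by linarith
  rcases ContinuousOn.strictMonoOn_of_injOn_Icc' hle (hc.mono fun y hy => (hsub hy).1)
    (hi.mono fun y hy => (hsub hy).1) with hm | hm <;>
  · have i1 := hm m1 m2 l1
    have i3 := hm m2 m3 l3
    rcases hUk with hk | hk
    · have := hk _ u1; have := hk _ u3; linarith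
    · have := hk _ u1; have := hk _ u3; linarith

/-- A continuous locally injective function on an interval is injective. -/
theorem injOn_of_locally_injOn {I : Set ℝ} (hI : IsOpen I) (hIc : I.OrdConnected) {k : ℝ → ℝ}
    (hk : ContinuousOn k I) (hloc : ∀ x ∈ I, ∃ W ∈ 𝓝 x, Set.InjOn k W) : Set.InjOn k I := by
  -- Rolle's argument without derivatives: equal end values force an interior extremum, which local
  -- injectivity forbids.
  have key : ∀ a ∈ I, ∀ b ∈ I, a < b → k a ≠ k b := by
    intro a ha b hb hab heq
    have hsub : Set.Icc a b ⊆ I := hIc.out ha hb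
    obtain ⟨c, hc, hext⟩ := exists_isLocalExtr_Ioo hab (hk.mono hsub) heq
    have hcI : c ∈ I := hsub (Set.Ioo_subset_Icc_self hc)
    obtain ⟨W, hW, hWi⟩ := hloc c hcI
    exact not_isLocalExtr_of_injOn (Filter.inter_mem hW (hI.mem_nhds hcI))
      (hk.mono Set.inter_subset_right) (hWi.mono Set.inter_subset_left) hext
  intro a ha b hb heq
  rcases lt_trichotomy a b with h | h | h
  exacts [(key a ha b hb h heq).elim, h, (key b hb a ha h heq.symm).elim]

theorem isOpen_re_preimage {I : Set ℝ} (hI : IsOpen I) : IsOpen (re ⁻¹' I) :=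
  hI.preimage continuous_re

/-- By the chain rule, the `y`-derivative of `V (x + iy)` is `i V'`, whose imaginary part is `Re
V'`. -/
theorem strictMono_im_of_re_deriv_pos {V : ℂ → ℂ} {x : ℝ}
    (hV : ∀ p : ℂ, p.re = x → DifferentiableAt ℂ V p) (hpos : ∀ p : ℂ, p.re = x → 0 < (deriv V p).re) :
    StrictMono fun y : ℝ => (V (x + y * I)).im := by
  have hd : ∀ y : ℝ, HasDerivAt (fun y : ℝ => (V (x + y * I)).im)
      (deriv V (x + y * I)).re y := by
    intro y
    have h1 : HasDerivAt (fun y : ℂ => (x : ℂ) + y * I) I (y : ℂ) := by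
      simpa using ((hasDerivAt_id (y : ℂ)).mul_const I).const_add (x : ℂ)
    have h2 := ((hV (x + y * I) (by simp)).hasDerivAt.comp (y : ℂ) h1).comp_ofReal
    have h3 := (imCLM.hasFDerivAt.comp_hasDerivAt y h2)
    simpa [Function.comp_def] using h3
  refine strictMono_of_deriv_pos fun y => ?_
  rw [(hd y).deriv]
  exact hpos _ (by simp)

/-- A level set of `Im V`, for `V` with `Re V' > 0` on a vertical strip, is the graph of a
continuous function as soon as it meets every vertical line. -/
theorem exists_continuousOn_level {J : Set ℝ} (hJ : IsOpen J) {V : ℂ → ℂ}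
    (hV : DifferentiableOn ℂ V (re ⁻¹' J)) (hpos : ∀ p ∈ re ⁻¹' J, 0 < (deriv V p).re) {c : ℝ}
    (hc : ∀ x ∈ J, ∃ y : ℝ, (V (x + y * I)).im = c) :
    ∃ γ : ℝ → ℂ, ContinuousOn γ J ∧ (∀ x ∈ J, (γ x).re = x) ∧
      {p | p ∈ re ⁻¹' J ∧ (V p).im = c} = γ '' J := by
  have hE := isOpen_re_preimage hJ
  have hdiff : ∀ p ∈ re ⁻¹' J, DifferentiableAt ℂ V p := fun p hp =>
    hV.differentiableAt (hE.mem_nhds hp)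
  have hmono : ∀ x ∈ J, StrictMono fun y : ℝ => (V (x + y * I)).im := fun x hx =>
    strictMono_im_of_re_deriv_pos (fun p hp => hdiff p (by simpa [hp] using hx))
      (fun p hp => hpos p (by simpa [hp] using hx))
  choose! y hy using hc
  have hcont : ∀ x ∈ J, ∀ a : ℝ, ContinuousAt (fun x : ℝ => (V (x + a * I)).im) x := by
    intro x hx a
    have h1 : ContinuousAt V ((x : ℂ) + a * I) := (hdiff _ (by simpa using hx)).continuousAt
    exact continuous_im.continuousAt.comp
      (ContinuousAt.comp (f := fun x : ℝ => (x : ℂ) + a * I) h1 (by fun_prop))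
  -- No implicit function theorem is needed: a strict inequality at a fixed height `a` persists for
  -- nearby `x`, and monotonicity turns it into a bound on `y`.
  have hyc : ContinuousOn y J := by
    intro x hx
    refine ContinuousAt.continuousWithinAt (tendsto_order.2 ⟨fun a ha => ?_, fun a ha => ?_⟩)
    · have h1 : (V (x + a * I)).im < c := by
        rw [← hy x hx]; exact hmono x hx ha
      filter_upwards [(hcont x hx a).eventually_lt_const h1, hJ.mem_nhds hx] with t ht htJ
      rw [← hy t htJ] at ht
      exact (hmono t htJ).lt_iff_lt.1 ht
    · have h1 : c < (V (x + a * I)).im := by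
        rw [← hy x hx]; exact hmono x hx ha
      filter_upwards [(hcont x hx a).eventually_const_lt h1, hJ.mem_nhds hx] with t ht htJ
      rw [← hy t htJ] at ht
      exact (hmono t htJ).lt_iff_lt.1 ht
  refine ⟨fun x => x + y x * I, ?_, fun x _ => by simp, ?_⟩
  · exact (continuous_ofReal.continuousOn).add
      ((continuous_ofReal.comp_continuousOn hyc).mul continuousOn_const)
  · ext p
    constructor
    · rintro ⟨hp, hpc⟩
      refine ⟨p.re, hp, ?_⟩
      have : y p.re = p.im := by
        apply (hmono p.re hp).injective
        simp only
        rw [hy _ hp, re_add_im, hpc]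
      simp [this]
    · rintro ⟨x, hx, rfl⟩
      exact ⟨by simpa using hx, hy x hx⟩

/-! ### The shear construction -/

theorem im_harmonicMap (H G : ℂ → ℂ) (p : ℂ) : (harmonicMap H G p).im = (H p - G p).im := by
  simp [harmonicMap, sub_eq_add_neg]

/-- The shear construction over a vertical strip or half-plane. -/
theorem shear_injOn_and_convex {J : Set ℝ} (hJ : IsOpen J) (hJc : J.OrdConnected)
    (hJn : J.Nonempty) {H G : ℂ → ℂ} (hH : DifferentiableOn ℂ H (re ⁻¹' J))
    (hG : DifferentiableOn ℂ G (re ⁻¹' J))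
    (hlt : ∀ p ∈ re ⁻¹' J, ‖deriv G p‖ < ‖deriv H p‖)
    (hpos : ∀ p ∈ re ⁻¹' J, 0 < (deriv (fun p => H p - G p) p).re)
    (hlev : ∀ p ∈ re ⁻¹' J, ∀ x ∈ J, ∃ y : ℝ,
      (H (x + y * I) - G (x + y * I)).im = (H p - G p).im) :
    Set.InjOn (harmonicMap H G) (re ⁻¹' J) ∧ IsOpen (harmonicMap H G '' (re ⁻¹' J)) ∧
      IsConnected (harmonicMap H G '' (re ⁻¹' J)) ∧
      ∀ c : ℝ, IsPreconnected ({w : ℂ | w.im = c} ∩ harmonicMap H G '' (re ⁻¹' J)) := by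
  have hE := isOpen_re_preimage hJ
  have hsH : ∀ p ∈ re ⁻¹' J, HasStrictDerivAt H (deriv H p) p := fun p hp =>
    (hH.analyticAt (hE.mem_nhds hp)).hasStrictDerivAt
  have hsG : ∀ p ∈ re ⁻¹' J, HasStrictDerivAt G (deriv G p) p := fun p hp =>
    (hG.analyticAt (hE.mem_nhds hp)).hasStrictDerivAt
  have hf : ContinuousOn (harmonicMap H G) (re ⁻¹' J) :=
    hH.continuousOn.add (continuous_conj.comp_continuousOn hG.continuousOn)
  have hlevel : ∀ p ∈ re ⁻¹' J, ∃ γ : ℝ → ℂ, ContinuousOn γ J ∧ (∀ x ∈ J, (γ x).re = x) ∧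
      {q | q ∈ re ⁻¹' J ∧ (H q - G q).im = (H p - G p).im} = γ '' J := fun p hp =>
    exists_continuousOn_level hJ (hH.sub hG) hpos (hlev p hp)
  refine ⟨?_, ?_, ?_, ?_⟩
  · intro p hp q hq hpq
    obtain ⟨γ, hγ, hγre, hset⟩ := hlevel p hp
    have hmem : ∀ x ∈ J, γ x ∈ re ⁻¹' J ∧ (H (γ x) - G (γ x)).im = (H p - G p).im := by
      intro x hx
      have : γ x ∈ γ '' J := ⟨x, hx, rfl⟩
      rwa [← hset] at this
    have hpγ : p ∈ γ '' J := by rw [← hset]; exact ⟨hp, rfl⟩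
    have hqγ : q ∈ γ '' J := by
      rw [← hset]
      refine ⟨hq, ?_⟩
      rw [← im_harmonicMap, ← im_harmonicMap, hpq]
    obtain ⟨s, hs, rfl⟩ := hpγ
    obtain ⟨t, ht, rfl⟩ := hqγ
    -- The imaginary part is constant along `γ`, so local injectivity of the planar map passes to
    -- its real part.
    have hinj : Set.InjOn (fun x => (harmonicMap H G (γ x)).re) J := by
      refine injOn_of_locally_injOn hJ hJc
        (continuous_re.comp_continuousOn (hf.comp hγ fun x hx => (hmem x hx).1)) fun x hx => ?_
      obtain ⟨U, hU, hUi⟩ :=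
        exists_injOn_harmonicMap (hsH _ (hmem x hx).1) (hsG _ (hmem x hx).1) (hlt _ (hmem x hx).1)
      refine ⟨γ ⁻¹' U ∩ J, Filter.inter_mem
        ((hγ.continuousAt (hJ.mem_nhds hx)) hU) (hJ.mem_nhds hx), ?_⟩
      rintro u ⟨hu, huJ⟩ v ⟨hv, hvJ⟩ huv
      have h1 : γ u = γ v := hUi hu hv (Complex.ext huv (by
        rw [im_harmonicMap, im_harmonicMap, (hmem u huJ).2, (hmem v hvJ).2]))
      rw [← hγre u huJ, ← hγre v hvJ, h1]
    rw [hinj hs ht (congrArg re hpq)]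
  · rw [isOpen_iff_mem_nhds]
    rintro _ ⟨p, hp, rfl⟩
    rw [← map_nhds_harmonicMap (hsH p hp) (hsG p hp) (hlt p hp)]
    exact Filter.image_mem_map (hE.mem_nhds hp)
  · refine IsConnected.image ⟨?_, ?_⟩ _ hf
    · obtain ⟨x, hx⟩ := hJn
      exact ⟨(x : ℂ), by simpa using hx⟩
    · exact ((convex_iff_ordConnected.2 hJc).is_linear_preimage reLm.isLinear).isPreconnected
  · intro c
    by_cases hne : ∃ p ∈ re ⁻¹' J, (H p - G p).im = c
    · obtain ⟨p, hp, rfl⟩ := hne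
      obtain ⟨γ, hγ, -, hset⟩ := hlevel p hp
      have : {w : ℂ | w.im = (H p - G p).im} ∩ harmonicMap H G '' (re ⁻¹' J) =
          harmonicMap H G '' (γ '' J) := by
        rw [← hset]
        ext w
        constructor
        · rintro ⟨hw, q, hq, rfl⟩
          exact ⟨q, ⟨hq, by rw [← im_harmonicMap]; exact hw⟩, rfl⟩
        · rintro ⟨q, ⟨hq, hqc⟩, rfl⟩
          exact ⟨by rw [Set.mem_ofPred_eq, im_harmonicMap, hqc], q, hq, rfl⟩
      rw [this]
      refine (hJc.isPreconnected.image _ hγ).image _ (hf.mono ?_)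
      rw [← hset]
      exact fun q hq => hq.1
    · convert isPreconnected_empty
      rw [Set.eq_empty_iff_forall_notMem]
      rintro w ⟨hw, q, hq, rfl⟩
      exact hne ⟨q, hq, by rw [← im_harmonicMap]; exact hw⟩

/-! ### The shear target and its strip parametrizations -/

/-- The shear target `(A / 2) log ((1 + w) / (1 - w)) + B w / (1 - 2 c w + w²)`. -/
noncomputable def shearTarget (A B c : ℝ) (w : ℂ) : ℂ :=
  A * (1 / 2 * log ((1 + w) / (1 - w))) + B * (w * (1 - 2 * w * c + w ^ 2)⁻¹)

theorem exp_mul_logPsiCombination (A B μ ν : ℝ) (z : ℂ) :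
    exp (μ * I) * logPsiCombination A B μ ν z =
      shearTarget A B (Real.cos ν) (z * exp (μ * I)) := by
  have h : exp (2 * (μ : ℂ) * I) = exp (μ * I) ^ 2 := by
    rw [← Complex.exp_nat_mul]; congr 1; push_cast; ring
  have h0 := Complex.exp_ne_zero (μ * I)
  have h1 : 1 - 2 * z * exp (μ * I) * (Real.cos ν : ℂ) + z ^ 2 * exp (2 * (μ : ℂ) * I) =
      1 - 2 * (z * exp (μ * I)) * (Real.cos ν : ℂ) + (z * exp (μ * I)) ^ 2 := by
    rw [h]; ring
  rw [logPsiCombination, shearTarget, psi, h1]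
  field_simp

/-- `φ` is parametrized over the vertical strip (or half-plane) over `J` by a function with
derivative of positive real part, every level of whose imaginary part meets all vertical lines. -/
def HasStripParametrization (φ : ℂ → ℂ) : Prop :=
  ∃ (J : Set ℝ) (σ Φ : ℂ → ℂ), IsOpen J ∧ J.OrdConnected ∧ J.Nonempty ∧
    DifferentiableOn ℂ σ (re ⁻¹' J) ∧ σ '' (re ⁻¹' J) = unitDisk ∧
    (∀ p ∈ re ⁻¹' J, φ (σ p) = Φ p) ∧
    (∀ p ∈ re ⁻¹' J, 0 < (deriv Φ p).re) ∧
    ∀ p ∈ re ⁻¹' J, ∀ x ∈ J, ∃ y : ℝ, (Φ (x + y * I)).im = (Φ p).im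

theorem mem_unitDisk {z : ℂ} : z ∈ unitDisk ↔ ‖z‖ < 1 := by simp [unitDisk]

theorem HasStripParametrization.neg_comp_neg {φ ψ : ℂ → ℂ} (h : HasStripParametrization φ)
    (hψ : ∀ w ∈ unitDisk, ψ w = -φ (-w)) : HasStripParametrization ψ := by
  obtain ⟨J, σ, Φ, hJ, hJc, ⟨x₀, hx₀⟩, hσ, him, hφ, hpos, hlev⟩ := h
  have hE : ∀ p : ℂ, p ∈ re ⁻¹' (-J) → -p ∈ re ⁻¹' J := fun p hp => by simpa using hp
  have hmem : ∀ p ∈ re ⁻¹' J, σ p ∈ unitDisk := fun p hp => him ▸ ⟨p, hp, rfl⟩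
  have hneg : ∀ w, -w ∈ unitDisk ↔ w ∈ unitDisk := fun w => by simp [mem_unitDisk]
  refine ⟨-J, fun p => -σ (-p), fun p => -Φ (-p), hJ.neg, ?_, ⟨-x₀, by simpa using hx₀⟩, ?_, ?_,
    ?_, ?_, ?_⟩
  · refine ⟨fun a ha b hb t ht => ?_⟩
    exact hJc.out (Set.mem_neg.1 hb) (Set.mem_neg.1 ha) ⟨neg_le_neg ht.2, neg_le_neg ht.1⟩
  · exact (hσ.comp differentiableOn_id.neg hE).neg
  · ext w
    constructor
    · rintro ⟨p, hp, rfl⟩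
      exact (hneg _).2 (hmem _ (hE p hp))
    · intro hw
      rw [← hneg, ← him] at hw
      obtain ⟨p, hp, hpw⟩ := hw
      exact ⟨-p, by simpa using hp, by simp [hpw]⟩
  · intro p hp
    rw [hψ _ ((hneg _).2 (hmem _ (hE p hp))), neg_neg, hφ _ (hE p hp)]
  · intro p hp
    have : deriv (fun p => -Φ (-p)) p = deriv Φ (-p) := by
      rw [deriv.fun_neg, deriv_comp_neg, neg_neg]
    rw [this]
    exact hpos _ (hE p hp)
  · intro p hp x hx
    obtain ⟨y, hy⟩ := hlev (-p) (hE p hp) (-x) hx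
    refine ⟨-y, ?_⟩
    rw [neg_im, neg_im, ← hy]
    congr 3
    push_cast; ring

theorem one_add_ne_zero_of_re_pos {s : ℂ} (hs : 0 < s.re) : s + 1 ≠ 0 := by
  intro h
  have := congrArg re h
  simp at this
  linarith

theorem cayley_mem_unitDisk {s : ℂ} (hs : 0 < s.re) : (s - 1) / (s + 1) ∈ unitDisk := by
  rw [mem_unitDisk, norm_div, div_lt_one (norm_pos_iff.2 (one_add_ne_zero_of_re_pos hs)),
    ← sq_lt_sq₀ (norm_nonneg _) (norm_nonneg _), ← normSq_eq_norm_sq, ← normSq_eq_norm_sq,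
    normSq_apply, normSq_apply]
  simp
  nlinarith

theorem one_sub_ne_zero_of_mem_unitDisk {w : ℂ} (hw : w ∈ unitDisk) : 1 - w ≠ 0 := by
  intro h
  rw [mem_unitDisk, ← sub_eq_zero.1 h] at hw
  simp at hw

theorem exists_cayley_eq {w : ℂ} (hw : w ∈ unitDisk) :
    ∃ s : ℂ, 0 < s.re ∧ (s - 1) / (s + 1) = w := by
  have h1 := one_sub_ne_zero_of_mem_unitDisk hw
  refine ⟨(1 + w) / (1 - w), ?_, ?_⟩
  · have h2 : w.re * w.re + w.im * w.im < 1 := by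
      rw [← normSq_apply, normSq_eq_norm_sq]
      have := mem_unitDisk.1 hw
      have := norm_nonneg w
      nlinarith
    rw [div_re, ← add_div]
    refine div_pos ?_ (normSq_pos.2 h1)
    simp
    nlinarith
  · have h3 : (1 + w) / (1 - w) + 1 = 2 / (1 - w) := by field_simp; ring
    have h4 : (1 + w) / (1 - w) - 1 = 2 * w / (1 - w) := by field_simp; ring
    rw [h3, h4]
    field_simp

/-- The Cayley variable turns the logarithm into `log s` and leaves a rational function of `s ^ 2`.
-/
theorem shearTarget_cayley (A B c : ℝ) {s : ℂ} (hs : 0 < s.re) :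
    shearTarget A B c ((s - 1) / (s + 1)) =
      A / 2 * log s + B * ((s ^ 2 - 1) * (2 * ((1 - c) * s ^ 2 + (1 + c)))⁻¹) := by
  have h1 := one_add_ne_zero_of_re_pos hs
  have h2 : (1 + (s - 1) / (s + 1)) / (1 - (s - 1) / (s + 1)) = s := by
    have h3 : 1 + (s - 1) / (s + 1) = 2 * s / (s + 1) := by field_simp; ring
    have h4 : 1 - (s - 1) / (s + 1) = 2 / (s + 1) := by field_simp; ring
    rw [h3, h4]
    field_simp
  have h5 : 1 - 2 * ((s - 1) / (s + 1)) * c + ((s - 1) / (s + 1)) ^ 2 =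
      2 * ((1 - c) * s ^ 2 + (1 + c)) / (s + 1) ^ 2 := by
    field_simp; ring
  rw [shearTarget, h2, h5, inv_div, div_eq_mul_inv (_ ^ 2)]
  have h6 : (s - 1) / (s + 1) * ((s + 1) ^ 2 * (2 * ((1 - c) * s ^ 2 + (1 + c)) : ℂ)⁻¹) =
      (s ^ 2 - 1) * (2 * ((1 - c) * s ^ 2 + (1 + c)) : ℂ)⁻¹ := by
    rw [← mul_assoc]; congr 1; field_simp; ring
  rw [h6]; ring

theorem differentiableOn_cayley_comp {J : Set ℝ} {s : ℂ → ℂ}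
    (hs : DifferentiableOn ℂ s (re ⁻¹' J)) (hpos : ∀ p ∈ re ⁻¹' J, 0 < (s p).re) :
    DifferentiableOn ℂ (fun p => (s p - 1) / (s p + 1)) (re ⁻¹' J) :=
  (hs.sub_const 1).div (hs.add_const 1) fun p hp => one_add_ne_zero_of_re_pos (hpos p hp)

theorem image_cayley_comp {J : Set ℝ} {s : ℂ → ℂ} (hpos : ∀ p ∈ re ⁻¹' J, 0 < (s p).re)
    (hsurj : ∀ w : ℂ, 0 < w.re → ∃ p ∈ re ⁻¹' J, s p = w) :
    (fun p => (s p - 1) / (s p + 1)) '' (re ⁻¹' J) = unitDisk := by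
  ext w
  constructor
  · rintro ⟨p, hp, rfl⟩
    exact cayley_mem_unitDisk (hpos p hp)
  · intro hw
    obtain ⟨t, ht, rfl⟩ := exists_cayley_eq hw
    obtain ⟨p, hp, rfl⟩ := hsurj t ht
    exact ⟨p, hp, rfl⟩

theorem re_inv_pos {z : ℂ} (hz : 0 < z.re) : 0 < (z⁻¹).re := by
  rw [inv_re]
  exact div_pos hz (normSq_pos.2 fun h => by simp [h] at hz)

theorem re_combination_pos {A B : ℝ} (hA : 0 ≤ A) (hB : 0 ≤ B) (hAB : 0 < A + B) {z : ℂ}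
    (hz : 0 < z.re) : 0 < (A * z⁻¹ + B * z).re := by
  have := re_inv_pos hz
  rw [add_re, re_ofReal_mul, re_ofReal_mul]
  rcases hA.eq_or_lt with rfl | hA'
  · simp only [zero_mul, zero_add] at *
    positivity
  · positivity

/-- A continuous function at bounded distance from a surjective increasing one is surjective. -/
theorem surjective_of_bounded_add {l r : ℝ → ℝ} {C : ℝ} (hl : Continuous l) (hr : Continuous r)
    (hlC : ∀ y, |l y| ≤ C) (htop : Filter.Tendsto r Filter.atTop Filter.atTop)
    (hbot : Filter.Tendsto r Filter.atBot Filter.atBot) :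
    Function.Surjective fun y => l y + r y :=
  (hl.add hr).surjective
    (Filter.tendsto_atTop_add_left_of_le _ (-C) (fun y => (abs_le.1 (hlC y)).1) htop)
    (Filter.tendsto_atBot_add_left_of_ge _ C (fun y => (abs_le.1 (hlC y)).2) hbot)

theorem continuous_im_log_comp {s : ℂ → ℂ} {x : ℝ} (A : ℝ)
    (hs : ∀ p : ℂ, p.re = x → ContinuousAt s p) (hpos : ∀ p : ℂ, p.re = x → 0 < (s p).re) :
    Continuous fun y : ℝ => A * (log (s (x + y * I))).im := by
  refine continuous_const.mul (continuous_im.comp (continuous_iff_continuousAt.2 fun y => ?_))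
  refine ContinuousAt.clog ?_ (Or.inl (hpos _ (by simp)))
  exact ContinuousAt.comp (f := fun y : ℝ => (x : ℂ) + y * I) (hs _ (by simp)) (by fun_prop)

theorem abs_mul_log_im_le {A : ℝ} (hA : 0 ≤ A) (z : ℂ) : |A * (log z).im| ≤ A * Real.pi := by
  rw [abs_mul, abs_of_nonneg hA, log_im]
  exact mul_le_mul_of_nonneg_left (abs_arg_le_pi z) hA

/-! ### The half-plane and strip cases -/

theorem hasStripParametrization_halfPlane {A B c : ℝ} (hA : 0 ≤ A) (hB : 0 ≤ B)
    (hAB : 0 < A + B) (hc : B = 0 ∨ c = 1) : HasStripParametrization (shearTarget A B c) := by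
  have hval : ∀ s : ℂ, 0 < s.re → shearTarget A B c ((s - 1) / (s + 1)) =
      (A / 2 : ℝ) * log s + (B / 4 : ℝ) * (s ^ 2 - 1) := by
    intro s hs
    rw [shearTarget_cayley A B c hs]
    rcases hc with rfl | rfl
    · simp
    · push_cast; norm_num; ring
  refine ⟨Set.Ioi 0, fun p => (p - 1) / (p + 1),
    fun s => (A / 2 : ℝ) * log s + (B / 4 : ℝ) * (s ^ 2 - 1), isOpen_Ioi, Set.ordConnected_Ioi,
    ⟨1, Set.mem_Ioi.2 one_pos⟩, differentiableOn_cayley_comp differentiableOn_id fun p hp => hp,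
    image_cayley_comp (s := id) (fun p hp => hp) fun w hw => ⟨w, hw, rfl⟩,
    fun p hp => hval p hp, ?_, ?_⟩
  · intro p hp
    have h1 : HasDerivAt (fun s : ℂ => (A / 2 : ℝ) * log s + (B / 4 : ℝ) * (s ^ 2 - 1))
        ((A / 2 : ℝ) * p⁻¹ + (B / 2 : ℝ) * p) p := by
      have h2 := ((hasDerivAt_log (Or.inl hp)).const_mul ((A / 2 : ℝ) : ℂ)).add
        ((((hasDerivAt_id p).pow 2).sub_const 1).const_mul ((B / 4 : ℝ) : ℂ))
      refine h2.congr_deriv ?_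
      simp
      ring
    rw [h1.deriv]
    exact re_combination_pos (by positivity) (by positivity) (by linarith) hp
  · intro p hp x hx
    have hp' : 0 < p.re := hp
    have hx' : 0 < x := hx
    rcases hB.eq_or_lt with rfl | hB'
    -- For `B = 0` the levels are those of `arg`, so the witness lies on the ray through `p`.
    · refine ⟨p.im * (x / p.re), ?_⟩
      have h1 : (x : ℂ) + (p.im * (x / p.re) : ℝ) * I = ((x / p.re : ℝ) : ℂ) * p := by
        apply Complex.ext <;> simp <;> field_simp
      simp only [h1]
      simp only [zero_div, ofReal_zero, zero_mul, add_zero, im_ofReal_mul, log_im,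
        arg_real_mul p (div_pos hx' hp')]
    · have hsurj := surjective_of_bounded_add (r := fun y : ℝ => B / 2 * x * y)
        (continuous_im_log_comp (s := id) (x := x) (A / 2) (fun p _ => continuousAt_id)
          (fun p hp => by simpa [hp] using hx')) (by fun_prop)
        (fun y => abs_mul_log_im_le (by positivity) _)
        (Filter.tendsto_id.const_mul_atTop (by positivity))
        (Filter.tendsto_id.const_mul_atBot (by positivity))
      obtain ⟨y, hy⟩ := hsurj ((A / 2 : ℝ) * log p + (B / 4 : ℝ) * (p ^ 2 - 1)).im
      refine ⟨y, ?_⟩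
      rw [← hy, add_im, im_ofReal_mul, im_ofReal_mul]
      simp [pow_two]
      ring

/-- Both real parts reduce to `sin x cos x > 0` for `x = Re t`, as `Re (sin t * cos t) = sin x cos x
(cosh² y + sinh² y)` and `Re (tan t) = sin x cos x / |cos t|²`. -/
theorem re_tan_pos {t : ℂ} (ht : t.re ∈ Set.Ioo 0 (Real.pi / 2)) :
    cos t ≠ 0 ∧ 0 < (sin t * cos t).re ∧ 0 < (tan t).re := by
  have hsin : 0 < Real.sin t.re := Real.sin_pos_of_pos_of_lt_pi ht.1 (by linarith [ht.2, Real.pi_pos])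
  have hcos : 0 < Real.cos t.re := Real.cos_pos_of_mem_Ioo ⟨by linarith [ht.1, Real.pi_pos], ht.2⟩
  have hch := Real.cosh_pos t.im
  have hsq := Real.cosh_sq t.im
  have hs2 := Real.sin_sq_add_cos_sq t.re
  have ecos : cos t = ((Real.cos t.re * Real.cosh t.im : ℝ) : ℂ) -
      ((Real.sin t.re * Real.sinh t.im : ℝ) : ℂ) * I := by
    rw [cos_eq]; push_cast; ring
  have esin : sin t = ((Real.sin t.re * Real.cosh t.im : ℝ) : ℂ) +
      ((Real.cos t.re * Real.sinh t.im : ℝ) : ℂ) * I := by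
    rw [sin_eq]; push_cast; ring
  have hc0 : cos t ≠ 0 := by
    intro h
    rw [ecos] at h
    have := congrArg re h
    simp only [sub_re, ofReal_re, re_ofReal_mul, I_re, mul_zero, sub_zero, zero_re] at this
    exact (mul_pos hcos hch).ne' this
  refine ⟨hc0, ?_, ?_⟩
  · rw [esin, ecos]
    simp only [mul_re, add_re, sub_re, add_im, sub_im, ofReal_re, ofReal_im, im_ofReal_mul, I_re,
      I_im]
    have : 0 < Real.sin t.re * Real.cos t.re := mul_pos hsin hcos
    nlinarith [sq_nonneg (Real.sinh t.im)]
  · rw [tan, div_re, ← add_div]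
    refine div_pos ?_ (normSq_pos.2 hc0)
    rw [esin, ecos]
    simp only [add_re, sub_re, add_im, sub_im, ofReal_re, ofReal_im, re_ofReal_mul,
      im_ofReal_mul, I_re, I_im]
    have : 0 < Real.sin t.re * Real.cos t.re := mul_pos hsin hcos
    nlinarith [sq_nonneg (Real.sinh t.im)]

theorem exists_tan_eq {w : ℂ} (hw : 0 < w.re) :
    ∃ t : ℂ, t.re ∈ Set.Ioo 0 (Real.pi / 2) ∧ tan t = w := by
  have hne1 : 1 - w * I ≠ 0 := by
    intro h
    have := congrArg im h
    simp at this
    linarith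
  refine ⟨arctan w, ?_, tan_arctan (fun h => by simp [h] at hw) (fun h => by simp [h] at hw)⟩
  have h1 : (arctan w).re = arg ((1 + w * I) / (1 - w * I)) / 2 := by
    simp [arctan, log_im]; ring
  have h2 : 0 < ((1 + w * I) / (1 - w * I)).im := by
    rw [div_im, ← sub_div]
    refine div_pos ?_ (normSq_pos.2 hne1)
    simp
    nlinarith
  rw [h1]
  have h3 := arg_nonneg_iff.2 h2.le
  have h4 : arg ((1 + w * I) / (1 - w * I)) ≠ 0 := fun h => h2.ne' (arg_eq_zero_iff.1 h).2
  have h5 : arg ((1 + w * I) / (1 - w * I)) ≠ Real.pi := fun h => h2.ne' (arg_eq_pi_iff.1 h).2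
  have h6 := (arg_le_pi ((1 + w * I) / (1 - w * I))).lt_of_ne h5
  have h7 := h3.lt_of_ne h4.symm
  exact ⟨by linarith, by linarith⟩

theorem im_sin_sq (x y : ℝ) :
    (sin (x + y * I) ^ 2).im = Real.sin (2 * x) * Real.sinh (2 * y) / 2 := by
  have esin : sin (x + y * I) = ((Real.sin x * Real.cosh y : ℝ) : ℂ) +
      ((Real.cos x * Real.sinh y : ℝ) : ℂ) * I := by
    rw [sin_eq]; simp
  rw [esin, pow_two, Real.sin_two_mul, Real.sinh_two_mul]
  simp only [mul_im, add_re, add_im, ofReal_re, ofReal_im, re_ofReal_mul, I_re, I_im]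
  ring

theorem hasStripParametrization_strip {A B c : ℝ} (hA : 0 ≤ A) (hB : 0 < B)
    (hc1 : -1 < c) (hc2 : c < 1) : HasStripParametrization (shearTarget A B c) := by
  obtain ⟨κ, hκ, hκc⟩ : ∃ κ : ℝ, 0 < κ ∧ (1 - c) * κ ^ 2 = 1 + c := by
    have h1 : 0 < (1 + c) / (1 - c) := div_pos (by linarith) (by linarith)
    -- This `κ` makes the denominator `(1 - c) s² + (1 + c)` collapse to `(1 + c) / cos² t` at `s =
    -- κ tan t`, leaving an affine function of `sin² t`.
    refine ⟨√((1 + c) / (1 - c)), Real.sqrt_pos.2 h1, ?_⟩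
    rw [Real.sq_sqrt h1.le, mul_div_cancel₀ _ (by linarith)]
  set M : ℝ := B / (2 * (1 + c)) with hM
  have hMpos : 0 < M := div_pos hB (by linarith)
  have hs : ∀ t ∈ re ⁻¹' Set.Ioo 0 (Real.pi / 2), 0 < ((κ : ℂ) * tan t).re := fun t ht => by
    rw [re_ofReal_mul]; exact mul_pos hκ (re_tan_pos ht).2.2
  have hval : ∀ t ∈ re ⁻¹' Set.Ioo 0 (Real.pi / 2),
      shearTarget A B c ((κ * tan t - 1) / (κ * tan t + 1)) =
        (A / 2 : ℝ) * log (κ * tan t) + M * ((κ ^ 2 + 1 : ℝ) * sin t ^ 2 - 1) := by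
    intro t ht
    rw [shearTarget_cayley A B c (hs t ht)]
    have h0 := (re_tan_pos ht).1
    have hb : (1 + c : ℂ) ≠ 0 := by
      exact_mod_cast (show (1 + c : ℝ) ≠ 0 by linarith)
    have hκc' : (1 - c : ℂ) * κ ^ 2 = 1 + c := by exact_mod_cast hκc
    have hsc := sin_sq_add_cos_sq t
    have h1 : (1 - c : ℂ) * (κ * tan t) ^ 2 + (1 + c) = (1 + c) / cos t ^ 2 := by
      rw [mul_pow, ← mul_assoc, hκc', tan, eq_div_iff (pow_ne_zero 2 h0)]
      field_simp
      rw [hsc]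
    rw [h1, tan, hM]
    push_cast
    congr 1
    field_simp
    linear_combination (-B : ℂ) * hsc
  have hsdiff : ∀ t ∈ re ⁻¹' Set.Ioo 0 (Real.pi / 2),
      HasDerivAt (fun t => (κ : ℂ) * tan t) (κ * (1 / cos t ^ 2)) t := fun t ht =>
    (hasDerivAt_tan (re_tan_pos ht).1).const_mul _
  refine ⟨Set.Ioo 0 (Real.pi / 2), fun t => (κ * tan t - 1) / (κ * tan t + 1),
    fun t => (A / 2 : ℝ) * log (κ * tan t) + M * ((κ ^ 2 + 1 : ℝ) * sin t ^ 2 - 1),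
    isOpen_Ioo, Set.ordConnected_Ioo, Set.nonempty_Ioo.2 (by positivity),
    differentiableOn_cayley_comp (s := fun t => κ * tan t)
      (fun t ht => (hsdiff t ht).differentiableAt.differentiableWithinAt) hs,
    image_cayley_comp (s := fun t => κ * tan t) hs fun w hw => ?_, hval, ?_, ?_⟩
  · have h1 : 0 < (((κ⁻¹ : ℝ) : ℂ) * w).re := by
      rw [re_ofReal_mul]; positivity
    obtain ⟨t, ht, htw⟩ := exists_tan_eq h1
    refine ⟨t, ht, ?_⟩
    have : (κ : ℂ) ≠ 0 := by exact_mod_cast hκ.ne'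
    simp only [htw]
    push_cast
    field_simp
  · intro t ht
    have h1 : HasDerivAt
        (fun t => (A / 2 : ℝ) * log (κ * tan t) + M * ((κ ^ 2 + 1 : ℝ) * sin t ^ 2 - 1))
        ((A / 2 : ℝ) * (sin t * cos t)⁻¹ + (2 * M * (κ ^ 2 + 1) : ℝ) * (sin t * cos t)) t := by
      have h2 := (((hsdiff t ht).clog (Or.inl (hs t ht))).const_mul ((A / 2 : ℝ) : ℂ)).add
        (((((hasDerivAt_sin t).pow 2).const_mul ((κ ^ 2 + 1 : ℝ) : ℂ)).sub_const 1).const_mul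
          (M : ℂ))
      refine h2.congr_deriv ?_
      have hκ0 : (κ : ℂ) ≠ 0 := by exact_mod_cast hκ.ne'
      have hc0 := (re_tan_pos ht).1
      have hs0 : sin t ≠ 0 := fun h => by simpa [h] using (re_tan_pos ht).2.1
      have h3 : (κ : ℂ) * (1 / cos t ^ 2) / (κ * tan t) = (sin t * cos t)⁻¹ := by
        rw [Complex.tan]; field_simp
      rw [h3]
      push_cast
      ring
    rw [h1.deriv]
    exact re_combination_pos (by positivity) (by positivity) (by positivity) (re_tan_pos ht).2.1
  · intro p hp x hx
    have hsin : 0 < Real.sin (2 * x) :=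
      Real.sin_pos_of_pos_of_lt_pi (by linarith [hx.1]) (by linarith [hx.2])
    -- The `sin²` term has imaginary part a positive multiple of `sinh (2 y)` on the line, while the
    -- logarithm's is bounded.
    have hm : 0 < M * (κ ^ 2 + 1) * Real.sin (2 * x) / 2 := by positivity
    have hsurj := surjective_of_bounded_add
      (r := fun y : ℝ => M * (κ ^ 2 + 1) * Real.sin (2 * x) / 2 * Real.sinh (2 * y))
      (continuous_im_log_comp (s := fun t => κ * tan t) (x := x) (A / 2)
        (fun p hp => (hsdiff p (by simpa [hp] using hx)).continuousAt)
        (fun p hp => hs p (by simpa [hp] using hx))) (by fun_prop)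
      (fun y => abs_mul_log_im_le (by positivity) _)
      ((Real.sinhOrderIso.tendsto_atTop.comp
        (Filter.tendsto_id.const_mul_atTop two_pos)).const_mul_atTop hm)
      ((Real.sinhOrderIso.tendsto_atBot.comp
        (Filter.tendsto_id.const_mul_atBot two_pos)).const_mul_atBot hm)
    obtain ⟨y, hy⟩ := hsurj
      ((A / 2 : ℝ) * log (κ * tan p) + M * ((κ ^ 2 + 1 : ℝ) * sin p ^ 2 - 1)).im
    refine ⟨y, ?_⟩
    rw [← hy, add_im, im_ofReal_mul, im_ofReal_mul, sub_im, im_ofReal_mul, im_sin_sq, one_im]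
    ring

theorem hasStripParametrization_shearTarget {A B c : ℝ} (hA : 0 ≤ A) (hB : 0 ≤ B)
    (hAB : 0 < A + B) (hc1 : -1 ≤ c) (hc2 : c ≤ 1) :
    HasStripParametrization (shearTarget A B c) := by
  rcases hB.eq_or_lt with rfl | hB'
  · exact hasStripParametrization_halfPlane hA le_rfl hAB (Or.inl rfl)
  rcases hc2.eq_or_lt with rfl | hc2'
  · exact hasStripParametrization_halfPlane hA hB hAB (Or.inr rfl)
  rcases hc1.eq_or_lt with rfl | hc1'
  -- The target for `c = -1` is the one for `c = 1` conjugated by `w ↦ -w`, that is, by `s ↦ s⁻¹`.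
  · refine (hasStripParametrization_halfPlane (c := 1) hA hB hAB (Or.inr rfl)).neg_comp_neg ?_
    intro w hw
    have hw' : -w ∈ unitDisk := by simpa [mem_unitDisk] using hw
    have h1 := one_sub_ne_zero_of_mem_unitDisk hw
    obtain ⟨s, hs, rfl⟩ := exists_cayley_eq hw
    have h2 := one_add_ne_zero_of_re_pos hs
    have h3 : -((s - 1) / (s + 1)) = (s⁻¹ - 1) / (s⁻¹ + 1) := by
      have : s ≠ 0 := fun h => by simp [h] at hs
      have h4 : s⁻¹ + 1 = (s + 1) / s := by field_simp; ring
      have h5 : s⁻¹ - 1 = (1 - s) / s := by field_simp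
      rw [h4, h5]; field_simp; ring
    have h6 : arg s ≠ Real.pi := fun h => by
      have := (arg_eq_pi_iff.1 h).1
      linarith
    have hs0 : s ≠ 0 := fun h => by simp [h] at hs
    rw [h3, shearTarget_cayley _ _ _ hs, shearTarget_cayley _ _ _ (re_inv_pos hs), log_inv _ h6]
    push_cast
    norm_num
    field_simp
    ring
  · exact hasStripParametrization_strip hA hB' hc1' hc2'

/-! ### Rotation and return to the disk -/

theorem isOpen_unitDisk : IsOpen unitDisk := Metric.isOpen_ball

theorem exp_neg_two_mul_I (μ : ℝ) : exp (-2 * (μ : ℂ) * I) = (exp (μ * I))⁻¹ ^ 2 := by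
  rw [← Complex.exp_neg, ← Complex.exp_nat_mul]; congr 1; push_cast; ring

theorem conj_exp_mul_I_inv (μ : ℝ) :
    (starRingEnd ℂ) (exp ((μ : ℂ) * I))⁻¹ = exp ((μ : ℂ) * I) := by
  rw [← Complex.exp_neg, ← Complex.exp_conj]
  simp

/-- A rotated set that is convex in the real direction. -/
theorem domainConvexInDirection_of_rotated {Ω Ω' : Set ℂ} {μ : ℝ}
    (hΩ : Ω' = (fun w => exp (μ * I) * w) '' Ω) (ho : IsOpen Ω') (hc : IsConnected Ω')
    (hconv : ∀ c : ℝ, IsPreconnected ({w : ℂ | w.im = c} ∩ Ω')) :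
    DomainConvexInDirection Ω (-μ) := by
  have h0 := Complex.exp_ne_zero (μ * I)
  have hmem : ∀ w, exp (μ * I) * w ∈ Ω' ↔ w ∈ Ω := fun w => by
    rw [hΩ]; exact (mul_right_injective₀ h0).mem_set_image
  have himg : ∀ S : Set ℂ, (fun w => (exp (μ * I))⁻¹ * w) '' S =
      (fun w => exp (μ * I) * w) ⁻¹' S := by
    intro S
    ext w
    constructor
    · rintro ⟨v, hv, rfl⟩
      simpa [mul_inv_cancel_left₀ h0] using hv
    · intro hw
      exact ⟨_, hw, inv_mul_cancel_left₀ h0 w⟩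
  have hΩ2 : Ω = (fun w => exp (μ * I) * w) ⁻¹' Ω' := by
    ext w; exact (hmem w).symm
  refine ⟨?_, ?_, fun c => ?_⟩
  · rw [hΩ2]; exact ho.preimage (by fun_prop)
  · rw [hΩ2, ← himg]; exact hc.image _ (by fun_prop)
  · convert (hconv (exp (μ * I) * c).im).image (fun w => (exp (μ * I))⁻¹ * w) (by fun_prop)
    rw [himg]
    ext w
    refine and_congr ?_ (hmem w).symm
    have he : exp (((-μ : ℝ) : ℂ) * I) = (exp (μ * I))⁻¹ := by
      rw [← Complex.exp_neg]; push_cast; congr 1; ring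
    rw [he]
    constructor
    · rintro ⟨t, rfl⟩
      have : exp (μ * I) * (c + t * (exp (μ * I))⁻¹) = exp (μ * I) * c + t := by
        field_simp
      simp [this]
    · intro hw
      refine ⟨(exp (μ * I) * w - exp (μ * I) * c).re, ?_⟩
      have h1 : (((exp (μ * I) * w - exp (μ * I) * c).re : ℝ) : ℂ) =
          exp (μ * I) * w - exp (μ * I) * c := by
        apply Complex.ext
        · rw [ofReal_re]
        · have hw' : (exp (μ * I) * w).im = (exp (μ * I) * c).im := hw
          rw [ofReal_im, sub_im, hw', sub_self]
      rw [h1]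
      field_simp
      ring

theorem univalentConvexInDirection_of_shear {μ ν A B : ℝ} (hA : 0 ≤ A) (hB : 0 ≤ B)
    (hAB : 0 < A + B) {h g : ℂ → ℂ} (hh : DifferentiableOn ℂ h unitDisk)
    (hg : DifferentiableOn ℂ g unitDisk) (hlt : ∀ z ∈ unitDisk, ‖deriv g z‖ < ‖deriv h z‖)
    (hs : ∀ z ∈ unitDisk, h z - exp (-2 * (μ : ℂ) * I) * g z = logPsiCombination A B μ ν z) :
    UnivalentConvexInDirection (harmonicMap h g) (-μ) := by
  obtain ⟨J, σ, Φ, hJ, hJc, hJn, hσ, him, hφ, hpos, hlev⟩ :=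
    hasStripParametrization_shearTarget hA hB hAB (Real.neg_one_le_cos ν) (Real.cos_le_one ν)
  have hE := isOpen_re_preimage hJ
  have h0 := Complex.exp_ne_zero (μ * I)
  have hn : ‖exp (μ * I)‖ = 1 := norm_exp_ofReal_mul_I μ
  set e := exp (μ * I) with he
  set R : ℂ → ℂ := fun p => e⁻¹ * σ p with hR
  have hRim : R '' (re ⁻¹' J) = unitDisk := by
    ext w
    have hw1 : ∀ w, e * w ∈ unitDisk ↔ w ∈ unitDisk := fun w => by
      rw [mem_unitDisk, mem_unitDisk, norm_mul, hn, one_mul]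
    rw [← hw1, ← him]
    constructor
    · rintro ⟨p, hp, rfl⟩
      exact ⟨p, hp, (mul_inv_cancel_left₀ h0 _).symm⟩
    · rintro ⟨p, hp, hpw⟩
      exact ⟨p, hp, by rw [hR]; simp only; rw [hpw, inv_mul_cancel_left₀ h0]⟩
  have hRmem : ∀ p ∈ re ⁻¹' J, R p ∈ unitDisk := fun p hp => hRim ▸ ⟨p, hp, rfl⟩
  have hRd : DifferentiableOn ℂ R (re ⁻¹' J) := hσ.const_mul _
  have hcomp : ∀ k : ℂ → ℂ, DifferentiableOn ℂ k unitDisk → ∀ a : ℂ, ∀ p ∈ re ⁻¹' J,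
      HasDerivAt (fun p => a * k (R p)) (a * (deriv k (R p) * deriv R p)) p := by
    intro k hk a p hp
    exact (((hk.differentiableAt (isOpen_unitDisk.mem_nhds (hRmem p hp))).hasDerivAt).comp p
      (hRd.differentiableAt (hE.mem_nhds hp)).hasDerivAt).const_mul a
  have hdiff : ∀ p ∈ re ⁻¹' J, e * h (R p) - e⁻¹ * g (R p) = Φ p := by
    intro p hp
    have h1 : e * (h (R p) - exp (-2 * (μ : ℂ) * I) * g (R p)) = Φ p := by
      rw [hs _ (hRmem p hp), he, exp_mul_logPsiCombination, ← he, ← hφ p hp]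
      congr 1
      rw [hR]; field_simp
    rw [← h1, exp_neg_two_mul_I, ← he]
    field_simp
  have hposE : ∀ p ∈ re ⁻¹' J, 0 < (deriv (fun p => e * h (R p) - e⁻¹ * g (R p)) p).re := by
    intro p hp
    have : (fun p => e * h (R p) - e⁻¹ * g (R p)) =ᶠ[𝓝 p] Φ := by
      filter_upwards [hE.mem_nhds hp] with q hq using hdiff q hq
    rw [this.deriv_eq]
    exact hpos p hp
  have key := shear_injOn_and_convex (H := fun p => e * h (R p)) (G := fun p => e⁻¹ * g (R p))
    hJ hJc hJn
    (fun p hp => (hcomp h hh _ p hp).differentiableAt.differentiableWithinAt)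
    (fun p hp => (hcomp g hg _ p hp).differentiableAt.differentiableWithinAt)
    (fun p hp => ?_) hposE (fun p hp x hx => ?_)
  · obtain ⟨hinj, hopen, hconn, hconv⟩ := key
    have hval : ∀ p, harmonicMap (fun p => e * h (R p)) (fun p => e⁻¹ * g (R p)) p =
        e * harmonicMap h g (R p) := fun p => by
      rw [harmonicMap, harmonicMap, map_mul, conj_exp_mul_I_inv, mul_add]
    constructor
    · intro z hz w hw hzw
      rw [← hRim] at hz hw
      obtain ⟨p, hp, rfl⟩ := hz
      obtain ⟨q, hq, rfl⟩ := hw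
      rw [hinj hp hq (by rw [hval, hval, hzw])]
    · refine domainConvexInDirection_of_rotated ?_ hopen hconn hconv
      rw [← hRim, Set.image_image, Set.image_image]
      exact Set.image_congr fun p _ => hval p
  · have h1 := hposE p hp
    have hdh := hcomp h hh e p hp
    have hdg := hcomp g hg e⁻¹ p hp
    rw [(hdh.fun_sub hdg).deriv] at h1
    -- `R'` is a factor of the derivative of `H - G`, whose real part is positive.
    have hR0 : deriv R p ≠ 0 := fun h => by simp [h] at h1
    rw [hdh.deriv, hdg.deriv, norm_mul, norm_mul, norm_mul, norm_mul, norm_inv, hn, inv_one,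
      one_mul, one_mul]
    exact mul_lt_mul_of_pos_right (hlt _ (hRmem p hp)) (norm_pos_iff.2 hR0)
  · obtain ⟨y, hy⟩ := hlev p hp x hx
    refine ⟨y, ?_⟩
    rw [hdiff p hp, ← hy, ← hdiff _ (show (x + y * I : ℂ) ∈ re ⁻¹' J by simpa using hx)]

/-! ### Dilatations of combinations -/

theorem IsLocallyUnivalentSensePreserving.norm_deriv_lt {h g : ℂ → ℂ}
    (hf : IsLocallyUnivalentSensePreserving h g) {z : ℂ} (hz : z ∈ unitDisk) :
    ‖deriv g z‖ < ‖deriv h z‖ := by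
  have h1 := (hf.analytic_h.analyticAt (isOpen_unitDisk.mem_nhds hz)).hasStrictDerivAt
  have h2 := (hf.analytic_g.analyticAt (isOpen_unitDisk.mem_nhds hz)).hasStrictDerivAt
  have h3 := hf.sensePreserving z hz
  rw [(hasStrictFDerivAt_harmonicMap h1 h2).hasFDerivAt.fderiv, det_harmonicDerivative] at h3
  exact lt_of_pow_lt_pow_left₀ 2 (norm_nonneg _) (by linarith)

/-- The real part equals `|a|² - |b|²`. With `a - b` fixed, this form is real-affine in `a + b`. -/
theorem norm_lt_norm_iff_re_mul_conj (a b : ℂ) :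
    ‖b‖ < ‖a‖ ↔ 0 < ((a - b) * (starRingEnd ℂ) (a + b)).re := by
  rw [← sq_lt_sq₀ (norm_nonneg _) (norm_nonneg _), ← normSq_eq_norm_sq, ← normSq_eq_norm_sq,
    normSq_apply, normSq_apply, ← sub_pos]
  simp
  constructor <;> intro h <;> linarith

/-- Convex combinations preserve `‖b‖ < ‖a‖` when the differences `a - b` agree. -/
theorem norm_convexCombination_lt {a₁ b₁ a₂ b₂ : ℂ} (h₁ : ‖b₁‖ < ‖a₁‖) (h₂ : ‖b₂‖ < ‖a₂‖)
    (hab : a₁ - b₁ = a₂ - b₂) {η : ℝ} (h0 : 0 ≤ η) (h1 : η ≤ 1) :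
    ‖η * b₁ + (1 - η) * b₂‖ < ‖η * a₁ + (1 - η) * a₂‖ := by
  rw [norm_lt_norm_iff_re_mul_conj] at *
  have e1 : ((η : ℂ) * a₁ + (1 - η) * a₂ - (η * b₁ + (1 - η) * b₂)) = a₁ - b₁ := by
    linear_combination (η - 1 : ℂ) * hab
  rw [← hab] at h₂
  have e2 : (a₁ - b₁) * (starRingEnd ℂ) (η * a₁ + (1 - η) * a₂ + (η * b₁ + (1 - η) * b₂)) =
      (η : ℂ) * ((a₁ - b₁) * (starRingEnd ℂ) (a₁ + b₁)) +
        ((1 - η : ℝ) : ℂ) * ((a₁ - b₁) * (starRingEnd ℂ) (a₂ + b₂)) := by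
    simp only [map_add, map_mul, map_sub, map_one, conj_ofReal]
    push_cast
    ring
  rw [e1, e2, add_re, re_ofReal_mul, re_ofReal_mul]
  rcases h0.eq_or_lt with rfl | h0'
  · simpa using h₂
  · have := mul_pos h0' h₁
    have := mul_nonneg (sub_nonneg.2 h1) h₂.le
    linarith

/-- With `u`, `v` the two quotients, multiplying by `1 - u` brings out the common factor `a₂`. The
claim becomes a comparison of `1 - u` with `v (1 - u)`, both shifted by `η (u - v)`, and follows
from `2 |η| |u - v| < |1 - u| (1 - |v|)`. -/
theorem norm_smallCombination_lt {a₁ b₁ a₂ b₂ : ℂ} (h₁ : ‖b₁‖ < ‖a₁‖) (h₂ : ‖b₂‖ < ‖a₂‖)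
    (hab : a₁ - b₁ = a₂ - b₂) {α₁ α₂ : ℝ} (hα₁ : α₁ ≤ 1) (hα₂ : α₂ ≤ 1) (hω₁ : ‖b₁ / a₁‖ < α₁)
    (hω₂ : ‖b₂ / a₂‖ < α₂) {η : ℂ} (hη : ‖η‖ ≤ (1 - α₁) * (1 - α₂) / (2 * (α₁ + α₂))) :
    ‖η * b₁ + (1 - η) * b₂‖ < ‖η * a₁ + (1 - η) * a₂‖ := by
  have ha₁ : a₁ ≠ 0 := norm_pos_iff.1 ((norm_nonneg _).trans_lt h₁)
  have ha₂ : a₂ ≠ 0 := norm_pos_iff.1 ((norm_nonneg _).trans_lt h₂)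
  obtain ⟨u, hu⟩ : ∃ u, u = b₁ / a₁ := ⟨_, rfl⟩
  obtain ⟨v, hv⟩ : ∃ v, v = b₂ / a₂ := ⟨_, rfl⟩
  have hb₁ : b₁ = u * a₁ := by rw [hu]; field_simp
  have hb₂ : b₂ = v * a₂ := by rw [hv]; field_simp
  rw [← hu] at hω₁
  rw [← hv] at hω₂
  have hα₁0 := (norm_nonneg _).trans_lt hω₁
  have hα₂0 := (norm_nonneg _).trans_lt hω₂
  have hd : (1 - u) * a₁ = (1 - v) * a₂ := by rw [hb₁, hb₂] at hab; linear_combination hab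
  have hu1 : 1 - α₁ < ‖1 - u‖ := by
    have := norm_sub_norm_le 1 u
    rw [norm_one] at this
    linarith
  have hu0 : 1 - u ≠ 0 := norm_pos_iff.1 (by linarith)
  have eh : (1 - u) * (η * a₁ + (1 - η) * a₂) = a₂ * (1 - u + η * (u - v)) := by
    linear_combination η * hd
  have eg : (1 - u) * (η * b₁ + (1 - η) * b₂) = a₂ * (v * (1 - u) + η * (u - v)) := by
    rw [hb₁, hb₂]; linear_combination η * u * hd
  have hη' : 2 * (‖η‖ * ‖u - v‖) ≤ (1 - α₁) * (1 - α₂) := by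
    rw [le_div_iff₀ (by linarith)] at hη
    have h3 : ‖u - v‖ ≤ α₁ + α₂ := (norm_sub_le _ _).trans (by linarith)
    have := mul_le_mul_of_nonneg_left h3 (norm_nonneg η)
    linarith
  -- Strictness comes from `|u| < α₁` and `|v| < α₂`, so equality in the bound on `η`, and `αₖ = 1`,
  -- are allowed.
  have hstrict : (1 - α₁) * (1 - α₂) < ‖1 - u‖ * (1 - ‖v‖) :=
    mul_lt_mul'' hu1 (by linarith) (by linarith) (by linarith)
  have key : ‖v * (1 - u) + η * (u - v)‖ < ‖1 - u + η * (u - v)‖ := by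
    have h3 := norm_add_le (v * (1 - u)) (η * (u - v))
    have h4 := norm_sub_le (1 - u + η * (u - v)) (η * (u - v))
    rw [add_sub_cancel_right] at h4
    rw [norm_mul, norm_mul] at h3
    rw [norm_mul] at h4
    linarith
  refine lt_of_mul_lt_mul_left ?_ (norm_nonneg (1 - u))
  rw [← norm_mul, ← norm_mul, eh, eg, norm_mul, norm_mul]
  exact mul_lt_mul_of_pos_left key (norm_pos_iff.2 ha₂)

theorem deriv_combination {h₁ h₂ : ℂ → ℂ} (hd₁ : DifferentiableOn ℂ h₁ unitDisk)
    (hd₂ : DifferentiableOn ℂ h₂ unitDisk) (η : ℂ) {z : ℂ} (hz : z ∈ unitDisk) :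
    deriv (fun z => η * h₁ z + (1 - η) * h₂ z) z = η * deriv h₁ z + (1 - η) * deriv h₂ z :=
  (((hd₁.differentiableAt (isOpen_unitDisk.mem_nhds hz)).hasDerivAt.const_mul η).add
    ((hd₂.differentiableAt (isOpen_unitDisk.mem_nhds hz)).hasDerivAt.const_mul (1 - η))).deriv

theorem mainTheorem10 (μ ν A B : ℝ) (hA : 0 ≤ A) (hB : 0 ≤ B) (hAB : 0 < A + B)
    (h₁ g₁ h₂ g₂ : ℂ → ℂ)
    (hf₁ : IsLocallyUnivalentSensePreserving h₁ g₁)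
    (hf₂ : IsLocallyUnivalentSensePreserving h₂ g₂)
    (hs₁ : ∀ z ∈ unitDisk,
      h₁ z - Complex.exp (-2 * (μ : ℂ) * Complex.I) * g₁ z = logPsiCombination A B μ ν z)
    (hs₂ : ∀ z ∈ unitDisk,
      h₂ z - Complex.exp (-2 * (μ : ℂ) * Complex.I) * g₂ z = logPsiCombination A B μ ν z) :
    (∀ η : ℝ, 0 ≤ η → η ≤ 1 →
      UnivalentConvexInDirection (combination (η : ℂ) h₁ g₁ h₂ g₂) (-μ)) ∧
    (∀ α₁ α₂ : ℝ, α₁ ≤ 1 → α₂ ≤ 1 →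
      (∀ z ∈ unitDisk, ‖dilatation h₁ g₁ z‖ < α₁) →
      (∀ z ∈ unitDisk, ‖dilatation h₂ g₂ z‖ < α₂) →
      ∀ η : ℂ, ‖η‖ ≤ (1 - α₁) * (1 - α₂) / (2 * (α₁ + α₂)) →
        UnivalentConvexInDirection (combination η h₁ g₁ h₂ g₂) (-μ)) := by
  have key : ∀ η : ℂ, (∀ z ∈ unitDisk, ‖η * deriv g₁ z + (1 - η) * deriv g₂ z‖ <
      ‖η * deriv h₁ z + (1 - η) * deriv h₂ z‖) →
      UnivalentConvexInDirection (combination η h₁ g₁ h₂ g₂) (-μ) := by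
    intro η hη
    refine univalentConvexInDirection_of_shear (ν := ν) hA hB hAB
      ((hf₁.analytic_h.const_mul η).add (hf₂.analytic_h.const_mul (1 - η)))
      ((hf₁.analytic_g.const_mul η).add (hf₂.analytic_g.const_mul (1 - η)))
      (fun z hz => ?_) (fun z hz => ?_)
    · rw [deriv_combination hf₁.analytic_h hf₂.analytic_h η hz,
        deriv_combination hf₁.analytic_g hf₂.analytic_g η hz]
      exact hη z hz
    · linear_combination η * hs₁ z hz + (1 - η) * hs₂ z hz
  have hderiv : ∀ h g : ℂ → ℂ, IsLocallyUnivalentSensePreserving h g → ∀ z ∈ unitDisk,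
      deriv (fun z => h z - exp (-2 * (μ : ℂ) * I) * g z) z =
        deriv h z - exp (-2 * (μ : ℂ) * I) * deriv g z := fun h g hf z hz =>
    ((hf.analytic_h.differentiableAt (isOpen_unitDisk.mem_nhds hz)).hasDerivAt.sub
      ((hf.analytic_g.differentiableAt
        (isOpen_unitDisk.mem_nhds hz)).hasDerivAt.const_mul _)).deriv
  have hne : ‖exp (-2 * (μ : ℂ) * I)‖ = 1 := by
    rw [exp_neg_two_mul_I, norm_pow, norm_inv, norm_exp_ofReal_mul_I, inv_one, one_pow]
  have hab : ∀ z ∈ unitDisk, deriv h₁ z - exp (-2 * (μ : ℂ) * I) * deriv g₁ z =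
      deriv h₂ z - exp (-2 * (μ : ℂ) * I) * deriv g₂ z := by
    intro z hz
    rw [← hderiv h₁ g₁ hf₁ z hz, ← hderiv h₂ g₂ hf₂ z hz]
    refine Filter.EventuallyEq.deriv_eq ?_
    filter_upwards [isOpen_unitDisk.mem_nhds hz] with w hw
    rw [hs₁ w hw, hs₂ w hw]
  -- Absorbing the unimodular factor into `b` leaves norms unchanged and makes the differences `a -
  -- b` agree.
  have hrot : ∀ η b₁ b₂ : ℂ, ‖η * b₁ + (1 - η) * b₂‖ =
      ‖η * (exp (-2 * (μ : ℂ) * I) * b₁) + (1 - η) * (exp (-2 * (μ : ℂ) * I) * b₂)‖ := by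
    intro η b₁ b₂
    rw [← one_mul ‖η * b₁ + (1 - η) * b₂‖, ← hne, ← norm_mul]
    congr 1; ring
  have hlt : ∀ h g : ℂ → ℂ, IsLocallyUnivalentSensePreserving h g → ∀ z ∈ unitDisk,
      ‖exp (-2 * (μ : ℂ) * I) * deriv g z‖ < ‖deriv h z‖ := fun h g hf z hz => by
    rw [norm_mul, hne, one_mul]; exact hf.norm_deriv_lt hz
  refine ⟨fun η h0 h1 => key η fun z hz => ?_, fun α₁ α₂ hα₁ hα₂ hω₁ hω₂ η hη => key η fun z hz => ?_⟩
  · rw [hrot]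
    exact norm_convexCombination_lt (hlt _ _ hf₁ z hz) (hlt _ _ hf₂ z hz) (hab z hz) h0 h1
  · rw [hrot]
    refine norm_smallCombination_lt (hlt _ _ hf₁ z hz) (hlt _ _ hf₂ z hz) (hab z hz) hα₁ hα₂
      ?_ ?_ hη
    · rw [mul_div_assoc, norm_mul, hne, one_mul]; exact hω₁ z hz
    · rw [mul_div_assoc, norm_mul, hne, one_mul]; exact hω₂ z hz
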